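/- Let $p$ be an odd prime and let $D_{2p}$ be the dihedral group of order $2p$. For a finite group $G$ and $S\subseteq G\setminus\{1\}$, the Cayley digraph $\mathrm{Cay}(G,S)$ has vertex set $G$ and an arc from $g$ to $h$ exactly when $hg^{-1}\in S$; its out-degree is $|S|$. A circulant digraph of order $p$ is a Cayley digraph on the cyclic group of order $p$, and a digraph is connected if its underlying undirected graph is connected. Let $\varphi$ be Euler's totient function, and put $$\mathcal M_{c,k}=\frac1{p-1}\sum_{d\mid\gcd(p-1,k)}\varphi(d)\binom{(p-1)/d}{k/d}\qquad(k\ge 0),$$ $$\mathcal M_k^1=\frac1{p-1}\left[\sum_{d\mid\gcd(p-1,k)}\varphi(d)\binom{2(p-1)/d}{k/d}+\sum_{d\mid\gcd(p-1,k-1)}\varphi(d)\binom{2(p-1)/d}{(k-1)/d}\right]\qquad(k\ge 1),$$ $$\mathcal M_k=\begin{cases}1 & \text{if } k=0 \text{ or } k=2p-1,\\[2pt] \dfrac1p\left[\dbinom{p-1}{k}-\dbinom{2p-1}{k}\right]+\mathcal M_k^1 & \text{if } 1\le k\le p-1,\\[8pt] \dfrac1p\left[\dbinom{p-1}{k-p}-\dbinom{2p-1}{k}\right]+\mathcal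 M_k^1 & \text{if } p\le k\le 2p-2,\end{cases}$$ where $\gcd(p-1,0)=p-1$. Then the number $\mathcal M_k'$ of connected Cayley digraphs on $D_{2p}$ of out-degree $k$, up to isomorphism of digraphs, is $$\mathcal M_k'=\begin{cases}0 & \text{if } k=0,1,\\ \mathcal M_k-\mathcal M_{c,k} & \text{if } 2\le k\le p-1,\\ \mathcal M_k & \text{if } p\le k\le 2p-1.\end{cases}$$ Moreover, for $0\le k\le 2p-1$, $\mathcal M_k$ is the number of all Cayley digraphs on $D_{2p}$ of out-degree $k$ up to isomorphism, and, for every $k\ge 0$, $\mathcal M_{c,k}$ is the number of circulant digraphs of order $p$ with out-degree $k$ up to isomorphism. -/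

import Mathlib

namespace CayleyEnum

/-- The Cayley digraph `Cay(G, S)`: there is an arc from `g` to `h` iff `h * g⁻¹ ∈ S`. -/
def cayleyDigraph {G : Type*} [Group G] (S : Set G) : Digraph G where
  Adj g h := h * g⁻¹ ∈ S

/-- `Γ` is a Cayley digraph on `G`: it is `Cay(G, S)` for some `S ⊆ G` with `1 ∉ S`. -/
def IsCayleyDigraph {G : Type*} [Group G] (Γ : Digraph G) : Prop :=
  ∃ S : Set G, (1 : G) ∉ S ∧ Γ = cayleyDigraph S

/-- Every vertex has exactly `k` out-neighbours (used for finite vertex sets). -/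
def HasOutDegree {V : Type*} (Γ : Digraph V) (k : ℕ) : Prop :=
  ∀ v : V, {w : V | Γ.Adj v w}.ncard = k

/-- A digraph is connected if its underlying undirected graph is connected. -/
def IsConnectedDigraph {V : Type*} (Γ : Digraph V) : Prop :=
  Γ.toSimpleGraphInclusive.Connected

/-- Isomorphism of digraphs: a bijection of the vertices that preserves and reflects arcs. -/
def isoSetoid (V : Type*) : Setoid (Digraph V) where
  r Γ Δ := Nonempty (Γ.Adj ≃r Δ.Adj)
  iseqv :=
    { refl := fun Γ => ⟨RelIso.refl Γ.Adj⟩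
      symm := fun ⟨e⟩ => ⟨e.symm⟩
      trans := fun ⟨e⟩ ⟨f⟩ => ⟨e.trans f⟩ }

/-- The number of isomorphism classes of digraphs on `V` with the property `P`. -/
noncomputable def numUpToIso {V : Type*} (P : Digraph V → Prop) : ℕ :=
  (Quotient.mk (isoSetoid V) '' {Γ | P Γ}).ncard

/-- The number of Cayley digraphs on the dihedral group of order `2 * p`
with out-degree `k`, up to isomorphism. -/
noncomputable def numDihedral (p k : ℕ) : ℕ :=
  numUpToIso fun Γ : Digraph (DihedralGroup p) => IsCayleyDigraph Γ ∧ HasOutDegree Γ k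

/-- The number of connected Cayley digraphs on the dihedral group of order `2 * p`
with out-degree `k`, up to isomorphism. -/
noncomputable def numConnectedDihedral (p k : ℕ) : ℕ :=
  numUpToIso fun Γ : Digraph (DihedralGroup p) =>
    IsCayleyDigraph Γ ∧ HasOutDegree Γ k ∧ IsConnectedDigraph Γ

/-- The number of circulant digraphs of order `p` (Cayley digraphs on the cyclic group
of order `p`) with out-degree `k`, up to isomorphism. -/
noncomputable def numCirculant (p k : ℕ) : ℕ :=
  numUpToIso fun Γ : Digraph (Multiplicative (ZMod p)) => IsCayleyDigraph Γ ∧ HasOutDegree Γ k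

/-- The sum of `φ(d) * C(n/d, k/d)` over the common divisors `d` of `p - 1` and `k`.
It is used for `n` a multiple of `p - 1`, so that both divisions are exact. -/
def totientSum (p n k : ℕ) : ℚ :=
  ∑ d ∈ (Nat.gcd (p - 1) k).divisors, (Nat.totient d : ℚ) * ((n / d).choose (k / d) : ℚ)

/-- The number `M_{c,k}`. -/
def Mc (p k : ℕ) : ℚ :=
  1 / ((p : ℚ) - 1) * totientSum p (p - 1) k

/-- The number `M_k^1` (used for `1 ≤ k`). -/
def M1 (p k : ℕ) : ℚ :=
  1 / ((p : ℚ) - 1) * (totientSum p (2 * (p - 1)) k + totientSum p (2 * (p - 1)) (k - 1))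

/-- The number `M_k`, for `0 ≤ k ≤ 2 * p - 1`. -/
def M (p k : ℕ) : ℚ :=
  if k = 0 ∨ k = 2 * p - 1 then 1
  else if k ≤ p - 1 then
    1 / (p : ℚ) * (((p - 1).choose k : ℚ) - ((2 * p - 1).choose k : ℚ)) + M1 p k
  else
    1 / (p : ℚ) * (((p - 1).choose (k - p) : ℚ) - ((2 * p - 1).choose k : ℚ)) + M1 p k

end CayleyEnum

namespace CayleyEnum

open Equiv

/-! The key fact is that isomorphic Cayley digraphs on `D_{2p}` have connection sets equivalent
under `Aut(D_{2p})`. Since `p` is odd, `p ^ 3` does not divide `(2p)!`, so a Sylow `p`-subgroup of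
any automorphism group on `2p` points is abelian. Hence an isomorphism can be corrected by an
automorphism until it conjugates right translation by `r 1` to a permutation commuting with it
(`exists_iso_commute`). Such an isomorphism is affine on each of the two cosets of the rotations
(`exists_affine_on_cosets`). If the two slopes differ, the reflection part of each connection set is
empty or full, so one slope serves for both (`exists_affine_of_iso_dihedral`). The cyclic group of
order `p` is simpler: there is only one coset.

Isomorphism classes are therefore orbits of the affine group on `k`-subsets of `(ZMod p)ˣ ⊕ ZMod p`,
and Burnside's lemma counts them. The identity fixes every point, a nontrivial translation has `p -
1` fixed points and one `p`-cycle, and an element with linear part of order `d > 1` has one fixed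
point and `2(p - 1)/d` cycles of length `d`. For circulants, `(ZMod p)ˣ` acts on itself.

For `k ≥ 2`, a Cayley digraph on `D_{2p}` is disconnected exactly when its connection set consists
of rotations; these classes are counted by `Mc`, which is subtracted. -/

/-! ### Sylow conjugation in automorphism groups -/

/-- A finite `p`-group whose order is not divisible by `p ^ 3` is commutative. -/
theorem mul_comm_of_isPGroup {G : Type*} [Group G] [Finite G] {p : ℕ} [hp : Fact p.Prime]
    (hG : IsPGroup p G) (h3 : ¬ p ^ 3 ∣ Nat.card G) (x y : G) : x * y = y * x := by
  obtain ⟨n, hn⟩ := IsPGroup.iff_card.mp hG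
  have hlt : n < 3 := by
    by_contra h
    exact h3 (hn ▸ pow_dvd_pow p (not_lt.mp h))
  interval_cases n
  · have := (Nat.card_eq_one_iff_unique.mp (by simpa using hn)).1
    exact Subsingleton.elim _ _
  · have : IsCyclic G := isCyclic_of_prime_card (by simpa using hn)
    exact this.isMulCommutative.is_comm.comm x y
  · have := IsPGroup.isMulCommutative_of_card_eq_prime_sq hn
    exact this.is_comm.comm x y

theorem isPGroup_zpowers_of_pow_eq_one {G : Type*} [Group G] {p : ℕ} {x : G} (hx : x ^ p = 1) :
    IsPGroup p (Subgroup.zpowers x) := by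
  rintro ⟨z, hz⟩
  obtain ⟨k, rfl⟩ := Subgroup.mem_zpowers_iff.mp hz
  refine ⟨1, Subtype.ext ?_⟩
  rw [pow_one, Subgroup.coe_pow, Subgroup.coe_one, ← zpow_natCast, zpow_comm, zpow_natCast, hx,
    one_zpow]

/-- Two elements of exponent `p` in a finite group whose order is not divisible by `p ^ 3`
commute up to conjugation. -/
theorem exists_conj_commute {G : Type*} [Group G] [Finite G] {p : ℕ} [Fact p.Prime]
    (h3 : ¬ p ^ 3 ∣ Nat.card G) {x y : G} (hx : x ^ p = 1) (hy : y ^ p = 1) :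
    ∃ g : G, Commute x (g * y * g⁻¹) := by
  obtain ⟨P, hP⟩ := (isPGroup_zpowers_of_pow_eq_one hx).exists_le_sylow
  obtain ⟨Q, hQ⟩ := (isPGroup_zpowers_of_pow_eq_one hy).exists_le_sylow
  obtain ⟨g, hg⟩ := MulAction.exists_smul_eq G Q P
  have hxP : x ∈ (P : Subgroup G) := hP (Subgroup.mem_zpowers x)
  have hyP : g * y * g⁻¹ ∈ (P : Subgroup G) := by
    rw [← hg, Sylow.coe_subgroup_smul]
    exact Subgroup.smul_mem_pointwise_smul y (MulAut.conj g) _ (hQ (Subgroup.mem_zpowers y))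
  refine ⟨g, ?_⟩
  have := mul_comm_of_isPGroup P.isPGroup'
    (fun h => h3 (h.trans (Subgroup.card_subgroup_dvd_card _))) ⟨x, hxP⟩ ⟨_, hyP⟩
  exact congrArg Subtype.val this

/-- The automorphism group of a digraph. -/
def autGroup {V : Type*} (Γ : Digraph V) : Subgroup (Perm V) where
  carrier := {σ | ∀ x y, Γ.Adj (σ x) (σ y) ↔ Γ.Adj x y}
  mul_mem' ha hb x y := (ha _ _).trans (hb x y)
  one_mem' _ _ := Iff.rfl
  inv_mem' {σ} h x y := by simpa using (h (σ⁻¹ x) (σ⁻¹ y)).symm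

/-- If `σ` is an automorphism of exponent `p` of two isomorphic digraphs, then some isomorphism
conjugates it into its own centralizer. -/
theorem exists_iso_commute {V : Type*} [Finite V] {p : ℕ} [Fact p.Prime]
    (h3 : ¬ p ^ 3 ∣ (Nat.card V).factorial) {Γ Δ : Digraph V} (f : Γ.Adj ≃r Δ.Adj)
    {σ : Perm V} (hσ : σ ^ p = 1) (hΓ : σ ∈ autGroup Γ) (hΔ : σ ∈ autGroup Δ) :
    ∃ e : Perm V, (∀ x y, Δ.Adj (e x) (e y) ↔ Γ.Adj x y) ∧ Commute σ (e⁻¹ * σ * e) := by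
  have hf : ∀ x y, Δ.Adj (f.toEquiv x) (f.toEquiv y) ↔ Γ.Adj x y := fun x y => f.map_rel_iff
  generalize f.toEquiv = f at hf
  have hτ : (f : Perm V)⁻¹ * σ * f ∈ autGroup Γ := fun x y => by
    rw [← hf]; simpa [hf] using hΔ (f x) (f y)
  have h3' : ¬ p ^ 3 ∣ Nat.card (autGroup Γ) := fun h => h3 <| by
    rw [← Nat.card_perm]
    exact h.trans (Subgroup.card_subgroup_dvd_card _)
  have hτp : ((f : Perm V)⁻¹ * σ * f) ^ p = 1 := by
    have := conj_pow (i := p) (a := (f : Perm V)⁻¹) (b := σ)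
    rw [inv_inv] at this
    rw [this, hσ]; simp
  obtain ⟨g, hg⟩ := exists_conj_commute h3' (x := ⟨σ, hΓ⟩) (y := ⟨_, hτ⟩)
    (Subtype.ext hσ) (Subtype.ext hτp)
  refine ⟨f * (g : Perm V)⁻¹, fun x y => ?_, ?_⟩
  · exact (hf _ _).trans ((autGroup Γ).inv_mem g.2 x y)
  · have := congrArg Subtype.val hg
    simp only [Subgroup.coe_mul, Subgroup.coe_inv] at this
    simpa [Commute, SemiconjBy, mul_assoc] using this

theorem not_prime_pow_three_dvd_factorial {p : ℕ} (hp : p.Prime) (hodd : Odd p) :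
    ¬ p ^ 3 ∣ (2 * p).factorial := by
  have h3 : 3 ≤ p := by
    have := hp.two_le
    rcases hodd with ⟨m, rfl⟩; omega
  -- Legendre's formula: as `2p < p ^ 2`, only the term `2p / p = 2` survives.
  rw [hp.pow_dvd_factorial_iff (b := 2) (Nat.log_lt_of_lt_pow (by omega) (by nlinarith))]
  simp [Nat.mul_div_cancel _ hp.pos]

theorem mulRight_mem_autGroup {G : Type*} [Group G] (S : Set G) (g : G) :
    Equiv.mulRight g ∈ autGroup (cayleyDigraph S) := by
  intro x y
  simp [cayleyDigraph, mul_assoc]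

/-- Translation-like behaviour of the conjugate `e⁻¹ * σ * e`, where `σ` is the right
multiplication by `g`. -/
theorem exists_iso_cayleyDigraph {G : Type*} [Group G] [Finite G] {p : ℕ} [Fact p.Prime]
    (h3 : ¬ p ^ 3 ∣ (Nat.card G).factorial) {S T : Set G}
    (f : (cayleyDigraph S).Adj ≃r (cayleyDigraph T).Adj) {g : G} (hg : g ^ p = 1) :
    ∃ e c : Perm G, (∀ x y, e y * (e x)⁻¹ ∈ T ↔ y * x⁻¹ ∈ S) ∧
      (∀ (x : G) (n : ℕ), c (x * g ^ n) = c x * g ^ n) ∧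
      (∀ (x : G) (n : ℕ), e ((c ^ n) x) = e x * g ^ n) := by
  obtain ⟨e, he, hc⟩ := exists_iso_commute h3 f (σ := Equiv.mulRight g)
    (by ext x; simp [hg]) (mulRight_mem_autGroup S g) (mulRight_mem_autGroup T g)
  refine ⟨e, e⁻¹ * Equiv.mulRight g * e, he, fun x n => ?_, fun x n => ?_⟩
  · have := congrArg (fun s : Perm G => s x) (hc.pow_left n)
    simpa using this.symm
  · have := conj_pow (i := n) (a := (e : Perm G)⁻¹) (b := Equiv.mulRight g)
    rw [inv_inv] at this
    rw [this]; simp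

/-! ### Isomorphisms induce affine maps of connection sets -/

/-- The permutation `c` commutes with translation by `1`, so it is translation by some `m ≠ 0`;
since `e` carries it to translation by `1`, `e` is affine of slope `m⁻¹`. -/
theorem exists_unit_of_iso_circulant {p : ℕ} (hp : p.Prime) (hodd : Odd p)
    {S T : Set (Multiplicative (ZMod p))}
    (f : (cayleyDigraph S).Adj ≃r (cayleyDigraph T).Adj) :
    ∃ a : (ZMod p)ˣ, ∀ x : ZMod p,
      Multiplicative.ofAdd x ∈ S ↔ Multiplicative.ofAdd (a * x) ∈ T := by
  have : Fact p.Prime := ⟨hp⟩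
  have : NeZero p := ⟨hp.ne_zero⟩
  have : Finite (Multiplicative (ZMod p)) := inferInstanceAs (Finite (ZMod p))
  have hcard : Nat.card (Multiplicative (ZMod p)) = p := by simp
  obtain ⟨e, c, he, hc, hec⟩ := exists_iso_cayleyDigraph (p := p) (g := Multiplicative.ofAdd 1)
    (fun h => not_prime_pow_three_dvd_factorial hp hodd (h.trans
      (Nat.factorial_dvd_factorial (by rw [hcard]; omega)))) f
    (by rw [← ofAdd_nsmul]; simp)
  have hg : ∀ x : ZMod p, Multiplicative.ofAdd x = Multiplicative.ofAdd 1 ^ x.val := fun x => by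
    rw [← ofAdd_nsmul]; simp
  set m := Multiplicative.toAdd (c 1) with hm
  have hcx : ∀ x, c (Multiplicative.ofAdd x) = Multiplicative.ofAdd (m + x) := fun x => by
    rw [hg x, ← one_mul (_ ^ _), hc, ← hg]; rfl
  have hcn : ∀ n : ℕ, (c ^ n) 1 = Multiplicative.ofAdd (n * m) := fun n => by
    induction n with
    | zero => simp
    | succ n ih => rw [pow_succ', Perm.mul_apply, ih, hcx]; congr 1; push_cast; ring
  have hm0 : m ≠ 0 := fun h => by
    have h1 := hec 1 1
    rw [hcn, h] at h1
    simp at h1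
  have hex : ∀ x, e (Multiplicative.ofAdd x) = e 1 * Multiplicative.ofAdd (m⁻¹ * x) := fun x => by
    rw [hg (m⁻¹ * x), ← hec, hcn]
    congr 2
    rw [ZMod.natCast_zmod_val]; field_simp
  refine ⟨(Units.mk0 m hm0)⁻¹, fun x => ?_⟩
  have := he 1 (Multiplicative.ofAdd x)
  rw [hex x] at this
  rw [← (by simpa using this : _ ↔ Multiplicative.ofAdd x ∈ S)]
  simp

/-- If `a' ≠ a`, then `x` makes the argument sweep the whole field, so `S` and `T` are both empty or
both full and any affine map will do. -/
theorem exists_affine_of_forall_mem_iff {F : Type*} [Field F] {S T : Set F} {a a' b : F}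
    (h : ∀ t x, t ∈ S ↔ a' * t + (a' - a) * x + b ∈ T) :
    ∃ b, ∀ t, t ∈ S ↔ a * t + b ∈ T := by
  by_cases haa : a' = a
  · exact ⟨b, fun t => by simpa [haa] using h t 0⟩
  · have h0 : a' - a ≠ 0 := sub_ne_zero.mpr haa
    refine ⟨0, fun t => ?_⟩
    rw [h t ((a * t + 0 - b - a' * t) / (a' - a)), mul_div_cancel₀ _ h0]
    ring_nf

open DihedralGroup in
/-- An isomorphism commuting suitably with a rotation is affine on both cosets of the rotations. -/
theorem exists_affine_on_cosets {p : ℕ} (hp : p.Prime) (hodd : Odd p)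
    {e c : Perm (DihedralGroup p)}
    (hc : ∀ (x : DihedralGroup p) (n : ℕ), c (x * r 1 ^ n) = c x * r 1 ^ n)
    (hec : ∀ (x : DihedralGroup p) (n : ℕ), e ((c ^ n) x) = e x * r 1 ^ n) :
    ∃ a a' : ZMod p, a ≠ 0 ∧ a' ≠ 0 ∧ (∀ x, e (r x) = e 1 * r (a * x)) ∧
      ∀ x, e (sr x) = e (sr 0) * r (a' * x) := by
  have : Fact p.Prime := ⟨hp⟩
  have : NeZero p := ⟨hp.ne_zero⟩
  have hg : ∀ x : ZMod p, r x = r 1 ^ x.val := fun x => by simp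
  have hcr : ∀ x, c (r x) = c 1 * r x := fun x => by
    rw [hg x, ← one_mul (_ ^ _), hc, one_mul]
  have hcsr : ∀ x, c (sr x) = c (sr 0) * r x := fun x => by
    rw [hg x, ← hc, ← hg]; simp
  have hne : ∀ x, c x ≠ x := fun x h => by
    have h1 := hec x 1
    rw [pow_one, h] at h1
    simp [DihedralGroup.one_def, -r_zero] at h1
  have hpow : c ^ p = 1 := by
    ext x
    apply e.injective
    rw [hec]; simp
  -- Injectivity forbids `c` to send both cosets into one. If it preserves them, it translates each.
  rcases hi : c 1 with i | i <;> rcases hj : c (sr 0) with j | j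
  · have : c (r (j - i)) = c (sr 0) := by rw [hcr, hi, hj]; simp
    simpa using c.injective this
  · have hi0 : i ≠ 0 := fun h => hne 1 (by rw [hi, h]; rfl)
    have hj0 : j ≠ 0 := fun h => hne (sr 0) (by rw [hj, h])
    have hcn : ∀ n : ℕ, (c ^ n) 1 = r ((n : ZMod p) * i) := fun n => by
      induction n with
      | zero => simp
      | succ n ih => rw [pow_succ', Perm.mul_apply, ih, hcr, hi, r_mul_r]; congr 1; push_cast; ring
    have hcn' : ∀ n : ℕ, (c ^ n) (sr 0) = sr ((n : ZMod p) * j) := fun n => by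
      induction n with
      | zero => simp
      | succ n ih =>
        rw [pow_succ', Perm.mul_apply, ih, hcsr, hj, sr_mul_r]; congr 1; push_cast; ring
    refine ⟨i⁻¹, j⁻¹, inv_ne_zero hi0, inv_ne_zero hj0, fun x => ?_, fun x => ?_⟩
    · rw [hg (i⁻¹ * x), ← hec, hcn, ZMod.natCast_zmod_val]
      congr 2; field_simp
    · rw [hg (j⁻¹ * x), ← hec, hcn', ZMod.natCast_zmod_val]
      congr 2; field_simp
  -- Here `c` swaps the cosets; its even powers preserve them, so the odd power `c ^ p` would swap
  -- them, contradicting `c ^ p = 1`.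
  · have h2 : ∀ n : ℕ, ∃ y, (c ^ (2 * n)) 1 = r y := fun n => by
      induction n with
      | zero => exact ⟨0, by simp⟩
      | succ n ih =>
        obtain ⟨y, hy⟩ := ih
        refine ⟨j + (i + y), ?_⟩
        rw [mul_add, mul_one, add_comm, pow_add, Perm.mul_apply, hy, pow_two, Perm.mul_apply, hcr,
          hi, sr_mul_r, hcsr, hj, r_mul_r]
    obtain ⟨m, hm⟩ := hodd
    obtain ⟨y, hy⟩ := h2 m
    have h3 : (c ^ p) 1 = c ((c ^ (2 * m)) 1) := by
      rw [← Perm.mul_apply, ← pow_succ', ← hm]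
    rw [hpow, hy, hcr, hi, sr_mul_r, Perm.one_apply, DihedralGroup.one_def] at h3
    simp [-r_zero] at h3
  · have : c (r (j - i)) = c (sr 0) := by rw [hcr, hi, hj]; simp
    simpa using c.injective this

open DihedralGroup in
/-- Isomorphic Cayley digraphs on a dihedral group of order `2 * p` have connection sets that
are equivalent under an automorphism of the group. -/
theorem exists_affine_of_iso_dihedral {p : ℕ} (hp : p.Prime) (hodd : Odd p)
    {S T : Set (DihedralGroup p)}
    (f : (cayleyDigraph S).Adj ≃r (cayleyDigraph T).Adj) :
    ∃ (a : (ZMod p)ˣ) (b : ZMod p), (∀ x, r x ∈ S ↔ r ((a : ZMod p) * x) ∈ T) ∧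
      ∀ x, sr x ∈ S ↔ sr ((a : ZMod p) * x + b) ∈ T := by
  have : Fact p.Prime := ⟨hp⟩
  have : NeZero p := ⟨hp.ne_zero⟩
  obtain ⟨e, c, he, hc, hec⟩ := exists_iso_cayleyDigraph (p := p) (g := r 1)
    (by rw [DihedralGroup.nat_card]; exact not_prime_pow_three_dvd_factorial hp hodd) f (by simp)
  obtain ⟨a, a', ha, ha', hr, hsr⟩ := exists_affine_on_cosets hp hodd hc hec
  rcases hi : e 1 with i | i <;> rcases hj : e (sr 0) with j | j
  · have : e (r (a⁻¹ * (j - i))) = e (sr 0) := by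
      rw [hr, hi, hj, mul_inv_cancel_left₀ ha]; simp
    simpa using e.injective this
  · obtain ⟨b, hb⟩ := exists_affine_of_forall_mem_iff (S := {x | sr x ∈ S}) (T := {x | sr x ∈ T})
      (a := a) (a' := a') (b := j - i) (fun t x => by
        have := he (r x) (sr (x + t))
        rw [hr, hsr, hi, hj] at this
        simp only [r_mul_r, sr_mul_r, inv_r] at this
        simp only [Set.mem_ofPred_eq]
        convert this.symm using 3 <;> ring)
    refine ⟨Units.mk0 a ha, b, fun x => ?_, hb⟩
    have := he 1 (r x)
    rw [hr, hi] at this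
    simpa using this.symm
  -- Here `e` swaps the cosets, and quotients of reflections reverse the sign of both slopes.
  · obtain ⟨b, hb⟩ := exists_affine_of_forall_mem_iff (S := {x | sr x ∈ S}) (T := {x | sr x ∈ T})
      (a := -a) (a' := -a') (b := i - j) (fun t x => by
        have := he (r x) (sr (x + t))
        rw [hr, hsr, hi, hj] at this
        simp only [r_mul_r, sr_mul_r, inv_r, inv_sr, r_mul_sr] at this
        simp only [Set.mem_ofPred_eq]
        convert this.symm using 3 <;> ring)
    refine ⟨Units.mk0 (-a) (neg_ne_zero.mpr ha), b, fun x => ?_, hb⟩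
    have := he 1 (r x)
    rw [hr, hi] at this
    simpa using this.symm
  · have : e (r (a⁻¹ * (j - i))) = e (sr 0) := by
      rw [hr, hi, hj, mul_inv_cancel_left₀ ha]; simp
    simpa using e.injective this

open Polynomial Pointwise

/-! ### Burnside's lemma and generating functions for fixed subsets -/

section Burnside

variable {G Y : Type*} [Group G] [MulAction G Y]

/-- The number of `k`-subsets fixed by `g`. -/
def numFixed (Y : Type*) [MulAction G Y] [Fintype Y] [DecidableEq Y] (g : G) (k : ℕ) : ℕ :=
  (Finset.univ.filter fun S : Finset Y => g • S = S ∧ S.card = k).card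

/-- The number of orbits on `k`-subsets. -/
noncomputable def numOrbits (G Y : Type*) [Group G] [MulAction G Y] [DecidableEq Y] (k : ℕ) : ℕ :=
  Nat.card (MulAction.orbitRel.Quotient G (Set.powersetCard Y k))

theorem sum_numFixed [Fintype Y] [DecidableEq Y] [Fintype G] (k : ℕ) :
    ∑ g : G, numFixed Y g k = numOrbits G Y k * Fintype.card G := by
  classical
  have : Fintype (MulAction.orbitRel.Quotient G (Set.powersetCard Y k)) := Fintype.ofFinite _
  have := MulAction.sum_card_fixedBy_eq_card_orbits_mul_card_group G (Set.powersetCard Y k)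
  rw [numOrbits, Nat.card_eq_fintype_card]
  refine Eq.trans (Finset.sum_congr rfl fun g _ => ?_) this
  rw [numFixed, ← Fintype.card_subtype]
  refine Fintype.card_congr
    { toFun := fun S => ⟨⟨S.1, S.2.2⟩, Subtype.ext S.2.1⟩
      invFun := fun S => ⟨S.1.1, congrArg Subtype.val S.2, S.1.2⟩
      left_inv := fun _ => rfl
      right_inv := fun _ => rfl }

/-- The generating function of the finite sets that are unions of fibres. -/
theorem sum_saturated_X_pow_card [Fintype Y] [DecidableEq Y] {Q : Type*} [Fintype Q] [DecidableEq Q] {f : Y → Q}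
    (hf : f.Surjective) :
    ∑ S : Finset Y with (∀ x y, f x = f y → x ∈ S → y ∈ S), (X : ℕ[X]) ^ S.card =
      ∏ q, (1 + X ^ (Finset.univ.filter fun y => f y = q).card) := by
  -- Expanding the product gives one term per set `T` of fibres, which corresponds to the preimage
  -- of `T`.
  rw [Finset.prod_one_add]
  symm
  refine Finset.sum_bij' (fun T _ => Finset.univ.filter fun y => f y ∈ T) (fun S _ => S.image f)
    ?_ ?_ ?_ ?_ ?_
  · intro T _
    simp only [Finset.mem_filter, Finset.mem_univ, true_and]
    intro x y h hx
    rwa [← h]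
  · simp
  · intro T _
    ext q
    obtain ⟨y, rfl⟩ := hf q
    simp only [Finset.mem_image, Finset.mem_filter, Finset.mem_univ, true_and]
    exact ⟨fun ⟨z, hz, h⟩ => h ▸ hz, fun h => ⟨y, h, rfl⟩⟩
  · intro S hS
    simp only [Finset.mem_filter, Finset.mem_univ, true_and] at hS
    ext y
    simp only [Finset.mem_image, Finset.mem_filter, Finset.mem_univ, true_and]
    exact ⟨fun ⟨z, hz, h⟩ => hS z y h hz, fun h => ⟨y, h, rfl⟩⟩
  · intro T _
    rw [Finset.prod_pow_eq_pow_sum]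
    congr 1
    rw [Finset.card_eq_sum_card_fiberwise (f := f) (t := T) (fun y hy => by simpa using hy)]
    refine Finset.sum_congr rfl fun q hq => ?_
    congr 1
    ext y
    simp only [Finset.mem_filter, Finset.mem_univ, true_and]
    exact ⟨fun h => ⟨h ▸ hq, h⟩, fun h => h.2⟩

theorem coeff_sum_X_pow_card [Fintype Y] (P : Finset Y → Prop) [DecidablePred P] (k : ℕ) :
    (∑ S : Finset Y with P S, (X : ℕ[X]) ^ S.card).coeff k =
      (Finset.univ.filter fun S : Finset Y => P S ∧ S.card = k).card := by
  simp only [finsetSum_coeff, coeff_X_pow]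
  rw [Finset.sum_boole, Finset.filter_filter]
  simp [eq_comm]

/-- The stabilizer of `S` contains all powers of `g`, so the fixed sets are the unions of cycles of
`g`. -/
theorem smul_finset_eq_iff_saturated [DecidableEq Y] (g : G) (S : Finset Y) :
    g • S = S ↔ ∀ x y, (Quotient.mk _ x : MulAction.orbitRel.Quotient (Subgroup.zpowers g) Y) =
      Quotient.mk _ y → x ∈ S → y ∈ S := by
  constructor
  · intro h x y hxy hx
    obtain ⟨⟨z, hz⟩, rfl⟩ := Quotient.exact hxy.symm
    have : z ∈ MulAction.stabilizer G S :=
      (Subgroup.zpowers_le (H := MulAction.stabilizer G S)).mpr h hz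
    rw [← MulAction.mem_stabilizer_iff.mp this]
    exact Finset.smul_mem_smul_finset hx
  · intro h
    refine Finset.eq_of_subset_of_card_le (fun y hy => ?_) (by simp)
    obtain ⟨x, hx, rfl⟩ := Finset.mem_smul_finset.mp hy
    exact h x _ (Quotient.sound ⟨⟨g⁻¹, by simp⟩, by simp [Subgroup.smul_def]⟩) hx

theorem card_fiber_orbit [Fintype Y] (g : G) (y : Y)
    [DecidableEq (MulAction.orbitRel.Quotient (Subgroup.zpowers g) Y)] :
    (Finset.univ.filter fun x =>
      (Quotient.mk _ x : MulAction.orbitRel.Quotient (Subgroup.zpowers g) Y) =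
        Quotient.mk _ y).card = MulAction.period g y := by
  classical
  have : MulAction.period g y = Function.minimalPeriod (g • ·) y := rfl
  rw [this, MulAction.minimalPeriod_eq_card, ← Fintype.card_subtype]
  exact Fintype.card_congr (Equiv.subtypeEquivRight fun x => by
    rw [Quotient.eq]; exact MulAction.orbitRel_apply)

/-- The number of fixed `k`-subsets of a group element with two orbit lengths. -/
theorem numFixed_eq_coeff [Fintype Y] [DecidableEq Y] (g : G) {d e m n : ℕ} (hde : d ≠ e) (hd0 : 0 < d) (he0 : 0 < e)
    (h : ∀ y : Y, MulAction.period g y = d ∨ MulAction.period g y = e)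
    (hm : (Finset.univ.filter fun y : Y => MulAction.period g y = d).card = d * m)
    (hn : (Finset.univ.filter fun y : Y => MulAction.period g y = e).card = e * n) (k : ℕ) :
    numFixed Y g k = (((1 + X ^ d) ^ m * (1 + X ^ e) ^ n : ℕ[X])).coeff k := by
  classical
  let Q := MulAction.orbitRel.Quotient (Subgroup.zpowers g) Y
  have : Fintype Q := Fintype.ofFinite _
  let f : Y → Q := fun y => Quotient.mk _ y
  have hf : f.Surjective := Quotient.mk_surjective
  let c : Q → ℕ := fun q => (Finset.univ.filter fun y => f y = q).card
  have hc : ∀ y, c (f y) = MulAction.period g y := fun y => card_fiber_orbit g y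
  -- Each cycle of length `j` accounts for `j` points of period `j`.
  have hcount : ∀ j i, 0 < j →
      (Finset.univ.filter fun y : Y => MulAction.period g y = j).card = j * i →
      (Finset.univ.filter fun q => c q = j).card = i := by
    intro j i hj hi
    rw [Finset.card_eq_sum_card_fiberwise (f := f) (t := Finset.univ.filter fun q => c q = j)
      (fun y hy => by simpa [hc] using hy)] at hi
    rw [Finset.sum_const_nat (m := j) (fun q hq => ?_), mul_comm] at hi
    · exact Nat.eq_of_mul_eq_mul_left hj hi
    · have hq' : c q = j := by simpa using hq
      rw [← hq', Finset.filter_filter]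
      congr 1
      ext y
      simp only [Finset.mem_filter, Finset.mem_univ, true_and, and_iff_right_iff_imp]
      rintro rfl
      rw [← hc]
  have key := sum_saturated_X_pow_card hf
  have hprod : ∏ q, (1 + (X : ℕ[X]) ^ c q) = (1 + X ^ d) ^ m * (1 + X ^ e) ^ n := by
    rw [← Finset.prod_filter_mul_prod_filter_not Finset.univ (fun q => c q = d)]
    have hnot : (Finset.univ.filter fun q => ¬ c q = d) = Finset.univ.filter fun q => c q = e := by
      ext q
      obtain ⟨y, rfl⟩ := hf q
      simp only [Finset.mem_filter, Finset.mem_univ, true_and, hc]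
      rcases h y with h | h <;> rw [h]
      · simp [hde]
      · simp [hde.symm]
    rw [hnot, Finset.prod_congr rfl (g := fun _ => 1 + (X : ℕ[X]) ^ d) (fun q hq => by
        rw [(Finset.mem_filter.mp hq).2]),
      Finset.prod_congr (s₁ := Finset.univ.filter fun q => c q = e) rfl
        (g := fun _ => 1 + (X : ℕ[X]) ^ e) (fun q hq => by rw [(Finset.mem_filter.mp hq).2]),
      Finset.prod_const, Finset.prod_const, hcount d m hd0 hm, hcount e n he0 hn]
  rw [← hprod, ← key, coeff_sum_X_pow_card, numFixed]
  congr 1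
  ext S
  simp only [Finset.mem_filter, Finset.mem_univ, true_and, smul_finset_eq_iff_saturated]
  rfl

end Burnside

/-! ### Totient sums over the unit group -/

/-- The number of `k`-subsets fixed by a permutation all of whose `n / d` cycles have length `d`. -/
def fixCount (n d k : ℕ) : ℕ := if d ∣ k then (n / d).choose (k / d) else 0

theorem coeff_one_add_X_pow_pow {n d : ℕ} (hd : 0 < d) (k : ℕ) :
    (((1 + X ^ d) ^ (n / d) : ℕ[X])).coeff k = fixCount n d k := by
  have : ((1 + X ^ d) ^ (n / d) : ℕ[X]) = expand ℕ d ((1 + X) ^ (n / d)) := by simp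
  rw [this, coeff_expand hd, fixCount]
  simp [coeff_one_add_X_pow]

/-- The unit group is cyclic of order `p - 1`, so it has `φ(d)` elements of each order `d` dividing
`p - 1`. -/
theorem sum_fixCount {p : ℕ} [hp : Fact p.Prime] (n k : ℕ) :
    ((∑ a : (ZMod p)ˣ, fixCount n (orderOf a) k : ℕ) : ℚ) = totientSum p n k := by
  have hcard : Fintype.card (ZMod p)ˣ = p - 1 := by
    rw [ZMod.card_units_eq_totient, Nat.totient_prime hp.out]
  have hp1 : p - 1 ≠ 0 := by have := hp.out.two_le; omega
  rw [← Finset.sum_fiberwise_of_maps_to (s := Finset.univ) (t := (p - 1).divisors)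
    (g := fun a : (ZMod p)ˣ => orderOf a) (fun a _ => by
      rw [Nat.mem_divisors, ← hcard]; exact ⟨orderOf_dvd_card, by rw [hcard]; exact hp1⟩)]
  have hdiv : (Nat.gcd (p - 1) k).divisors = (p - 1).divisors.filter (· ∣ k) := by
    ext d
    simp only [Nat.mem_divisors, Nat.dvd_gcd_iff, Finset.mem_filter, ne_eq, Nat.gcd_eq_zero_iff]
    tauto
  rw [totientSum, hdiv, Finset.sum_filter]
  push_cast
  refine Finset.sum_congr rfl fun d hd => ?_
  have hd' : d ∣ Fintype.card (ZMod p)ˣ := hcard ▸ Nat.dvd_of_mem_divisors hd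
  have h1 := IsCyclic.card_orderOf_eq_totient hd'
  rw [Finset.sum_congr rfl (g := fun _ => (fixCount n d k : ℚ)) (fun a ha => by
    rw [(Finset.mem_filter.mp ha).2]), Finset.sum_const, h1, nsmul_eq_mul, fixCount]
  split_ifs <;> simp

/-! ### The affine group and its action -/

/-- The group of affine maps `x ↦ a * x + b` of `ZMod p`. -/
@[ext]
structure Aff (p : ℕ) where
  lin : (ZMod p)ˣ
  trans : ZMod p

namespace Aff

variable {p : ℕ}

instance : Mul (Aff p) := ⟨fun g h => ⟨g.lin * h.lin, g.lin * h.trans + g.trans⟩⟩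
instance : One (Aff p) := ⟨⟨1, 0⟩⟩
instance : Inv (Aff p) := ⟨fun g => ⟨g.lin⁻¹, -(↑g.lin⁻¹ * g.trans)⟩⟩

@[simp] theorem mul_lin (g h : Aff p) : (g * h).lin = g.lin * h.lin := rfl
@[simp] theorem mul_trans (g h : Aff p) : (g * h).trans = g.lin * h.trans + g.trans := rfl
@[simp] theorem one_lin : (1 : Aff p).lin = 1 := rfl
@[simp] theorem one_trans : (1 : Aff p).trans = 0 := rfl
@[simp] theorem inv_lin (g : Aff p) : g⁻¹.lin = g.lin⁻¹ := rfl
@[simp] theorem inv_trans (g : Aff p) : g⁻¹.trans = -(↑g.lin⁻¹ * g.trans) := rfl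

instance : Group (Aff p) := Group.ofLeftAxioms
  (fun g h k => by ext <;> simp [mul_assoc]; ring)
  (fun g => by ext <;> simp)
  (fun g => by ext <;> simp)

/-- The underlying product. -/
def equivProd : Aff p ≃ (ZMod p)ˣ × ZMod p where
  toFun g := (g.lin, g.trans)
  invFun x := ⟨x.1, x.2⟩
  left_inv _ := rfl
  right_inv _ := rfl

instance [Fact p.Prime] : Fintype (Aff p) := Fintype.ofEquiv _ equivProd.symm

/-- Affine maps act on the nontrivial rotations (linearly) and on the reflections. -/
instance : MulAction (Aff p) ((ZMod p)ˣ ⊕ ZMod p) where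
  smul g := Sum.map (g.lin * ·) (fun x => g.lin * x + g.trans)
  one_smul y := by
    rcases y with u | x
    · exact congrArg Sum.inl (one_mul u)
    · exact congrArg Sum.inr (by simp)
  mul_smul g h y := by
    rcases y with u | x
    · exact congrArg Sum.inl (mul_assoc _ _ u)
    · exact congrArg Sum.inr (by simp; ring)

@[simp] theorem smul_inl (g : Aff p) (u : (ZMod p)ˣ) :
    g • (Sum.inl u : (ZMod p)ˣ ⊕ ZMod p) = Sum.inl (g.lin * u) := rfl

@[simp] theorem smul_inr (g : Aff p) (x : ZMod p) :
    g • (Sum.inr x : (ZMod p)ˣ ⊕ ZMod p) = Sum.inr (g.lin * x + g.trans) := rfl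

theorem pow_smul_inl (g : Aff p) (u : (ZMod p)ˣ) (n : ℕ) :
    g ^ n • (Sum.inl u : (ZMod p)ˣ ⊕ ZMod p) = Sum.inl (g.lin ^ n * u) := by
  induction n with
  | zero => simp
  | succ n ih => rw [pow_succ', mul_smul, ih, smul_inl, pow_succ', mul_assoc]

theorem pow_smul_inr_of_fixed {g : Aff p} {c : ZMod p} (hc : g.lin * c + g.trans = c) (x : ZMod p)
    (n : ℕ) : g ^ n • (Sum.inr x : (ZMod p)ˣ ⊕ ZMod p) =
      Sum.inr (((g.lin ^ n : (ZMod p)ˣ) : ZMod p) * (x - c) + c) := by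
  induction n with
  | zero => simp
  | succ n ih =>
    rw [pow_succ', mul_smul, ih, smul_inr, pow_succ']
    congr 1
    push_cast
    linear_combination hc

theorem pow_smul_inr_of_lin_eq_one {g : Aff p} (hg : g.lin = 1) (x : ZMod p) (n : ℕ) :
    g ^ n • (Sum.inr x : (ZMod p)ˣ ⊕ ZMod p) = Sum.inr (x + n * g.trans) := by
  induction n with
  | zero => simp
  | succ n ih =>
    rw [pow_succ', mul_smul, ih, smul_inr, hg]
    congr 1
    push_cast
    ring

end Aff

theorem period_eq_of_forall {G Y : Type*} [Group G] [MulAction G Y] {g : G} {y : Y} {d : ℕ}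
    (h : ∀ n : ℕ, g ^ n • y = y ↔ d ∣ n) : MulAction.period g y = d :=
  Nat.dvd_antisymm (MulAction.pow_smul_eq_iff_period_dvd.mp ((h d).mpr dvd_rfl))
    ((h _).mp (MulAction.pow_period_smul g y))

theorem numFixed_eq_fixCount {G Y : Type*} [Group G] [MulAction G Y] [Fintype Y] [DecidableEq Y]
    {g : G} {d : ℕ} (hd : 0 < d) (h : ∀ y : Y, MulAction.period g y = d)
    (hdvd : d ∣ Fintype.card Y) (k : ℕ) :
    numFixed Y g k = fixCount (Fintype.card Y) d k := by
  -- The second cycle length `d + 1` is a dummy that no point attains.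
  rw [numFixed_eq_coeff g (d := d) (e := d + 1) (m := Fintype.card Y / d) (n := 0) (by omega) hd
    (by omega) (fun y => Or.inl (h y)) _ _, pow_zero, mul_one, coeff_one_add_X_pow_pow hd]
  · rw [Nat.mul_div_cancel' hdvd]
    simp [h]
  · simp [h]

/-! ### Evaluation of the Burnside sums -/

section Count

variable {p : ℕ} [hp : Fact p.Prime]

theorem card_units_zmod : Fintype.card (ZMod p)ˣ = p - 1 := by
  rw [ZMod.card_units_eq_totient, Nat.totient_prime hp.out]

theorem orderOf_dvd_sub_one (a : (ZMod p)ˣ) : orderOf a ∣ p - 1 :=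
  card_units_zmod (p := p) ▸ orderOf_dvd_card

theorem numFixed_units (a : (ZMod p)ˣ) (k : ℕ) :
    numFixed (ZMod p)ˣ a k = fixCount (p - 1) (orderOf a) k := by
  rw [numFixed_eq_fixCount (orderOf_pos a) (fun u => period_eq_of_forall fun n => ?_) orderOf_dvd_card,
    card_units_zmod]
  rw [orderOf_dvd_iff_pow_eq_one, smul_eq_mul, mul_eq_right]

theorem numOrbits_units (k : ℕ) : (numOrbits (ZMod p)ˣ (ZMod p)ˣ k : ℚ) = Mc p k := by
  have h := sum_numFixed (G := (ZMod p)ˣ) (Y := (ZMod p)ˣ) k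
  simp only [numFixed_units, card_units_zmod] at h
  have h' := sum_fixCount (p := p) (p - 1) k
  rw [h] at h'
  have hp1 : (1 : ℚ) < p := by exact_mod_cast hp.out.one_lt
  push_cast [Nat.cast_sub hp.out.one_le] at h'
  rw [Mc, ← h']
  field_simp [sub_ne_zero.mpr hp1.ne']

theorem numFixed_aff_one (k : ℕ) :
    numFixed ((ZMod p)ˣ ⊕ ZMod p) (1 : Aff p) k = (2 * p - 1).choose k := by
  have hp1 := hp.out.one_le
  rw [numFixed_eq_fixCount one_pos (fun y => period_eq_of_forall fun n => by simp) (one_dvd _),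
    fixCount, Fintype.card_sum, card_units_zmod, ZMod.card]
  simp only [one_dvd, if_true, Nat.div_one]
  congr 1
  omega

/-- The rotations are fixed and the reflections form a single `p`-cycle, which a fixed subset
contains or avoids. -/
theorem numFixed_aff_of_lin_eq_one {g : Aff p} (hg : g.lin = 1) (hg' : g.trans ≠ 0) (k : ℕ) :
    numFixed ((ZMod p)ˣ ⊕ ZMod p) g k =
      (p - 1).choose k + if p ≤ k then (p - 1).choose (k - p) else 0 := by
  have hl : ∀ u, MulAction.period g (Sum.inl u : (ZMod p)ˣ ⊕ ZMod p) = 1 := fun u =>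
    period_eq_of_forall fun n => by
      rw [Aff.pow_smul_inl, hg]; simp
  have hr : ∀ x, MulAction.period g (Sum.inr x : (ZMod p)ˣ ⊕ ZMod p) = p := fun x =>
    period_eq_of_forall fun n => by
      rw [Aff.pow_smul_inr_of_lin_eq_one hg, Sum.inr.injEq, add_eq_left, mul_eq_zero,
        or_iff_left hg', ZMod.natCast_eq_zero_iff]
  have hp1 := hp.out.one_lt
  rw [numFixed_eq_coeff g (d := 1) (e := p) (m := p - 1) (n := 1) hp1.ne one_pos (by omega)]
  · rw [pow_one, pow_one, mul_add, mul_one, coeff_add, coeff_mul_X_pow', coeff_one_add_X_pow,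
      coeff_one_add_X_pow]
    simp
  · rintro (u | x)
    · exact Or.inl (hl u)
    · exact Or.inr (hr x)
  · rw [← Finset.univ_disjSum_univ, Finset.card_filter, Finset.sum_disjSum]
    simp only [hl, hr, hp1.ne']
    simp [card_units_zmod, -ZMod.card_units_eq_totient]
  · rw [← Finset.univ_disjSum_univ, Finset.card_filter, Finset.sum_disjSum]
    simp only [hl, hr, hp1.ne]
    simp

/-- The only fixed point is one reflection `c`; the two terms are the fixed subsets without and with
`c`. -/
theorem numFixed_aff_of_lin_ne_one {g : Aff p} (hg : g.lin ≠ 1) {k : ℕ} (hk : 1 ≤ k) :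
    numFixed ((ZMod p)ˣ ⊕ ZMod p) g k =
      fixCount (2 * (p - 1)) (orderOf g.lin) k + fixCount (2 * (p - 1)) (orderOf g.lin) (k - 1) := by
  have hg1 : (g.lin : ZMod p) - 1 ≠ 0 := sub_ne_zero.mpr fun h => hg (Units.ext h)
  obtain ⟨c, hc⟩ : ∃ c : ZMod p, g.lin * c + g.trans = c :=
    ⟨-g.trans / (g.lin - 1), by field_simp; ring⟩
  have hl : ∀ u, MulAction.period g (Sum.inl u : (ZMod p)ˣ ⊕ ZMod p) = orderOf g.lin := fun u =>
    period_eq_of_forall fun n => by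
      rw [Aff.pow_smul_inl, Sum.inl.injEq, mul_eq_right, orderOf_dvd_iff_pow_eq_one]
  have hr : ∀ x, x ≠ c → MulAction.period g (Sum.inr x : (ZMod p)ˣ ⊕ ZMod p) = orderOf g.lin :=
    fun x hx => period_eq_of_forall fun n => by
      rw [Aff.pow_smul_inr_of_fixed hc, Sum.inr.injEq, ← eq_sub_iff_add_eq,
        mul_eq_right₀ (sub_ne_zero.mpr hx), orderOf_dvd_iff_pow_eq_one, Units.val_eq_one]
  have hrc : MulAction.period g (Sum.inr c : (ZMod p)ˣ ⊕ ZMod p) = 1 :=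
    period_eq_of_forall fun n => by simp [Aff.pow_smul_inr_of_fixed hc]
  have hne : orderOf g.lin ≠ 1 := fun h => hg (orderOf_eq_one_iff.mp h)
  have hcase : ∀ y : (ZMod p)ˣ ⊕ ZMod p, y ≠ Sum.inr c → MulAction.period g y = orderOf g.lin := by
    rintro (u | x) h
    · exact hl u
    · exact hr x fun hx => h (hx ▸ rfl)
  have h1 : (Finset.univ.filter fun y : (ZMod p)ˣ ⊕ ZMod p => MulAction.period g y = 1) =
      {Sum.inr c} := by
    ext y
    simp only [Finset.mem_filter, Finset.mem_univ, true_and, Finset.mem_singleton]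
    refine ⟨fun h => ?_, fun h => h ▸ hrc⟩
    by_contra hy
    exact hne ((hcase y hy).symm.trans h)
  have h2 : (Finset.univ.filter fun y : (ZMod p)ˣ ⊕ ZMod p =>
      MulAction.period g y = orderOf g.lin) = Finset.univ.erase (Sum.inr c) := by
    ext y
    simp only [Finset.mem_filter, Finset.mem_univ, true_and, Finset.mem_erase, and_true]
    refine ⟨?_, hcase y⟩
    rintro h rfl
    exact hne (h.symm.trans hrc)
  rw [numFixed_eq_coeff g (d := orderOf g.lin) (e := 1) (m := 2 * (p - 1) / orderOf g.lin) (n := 1)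
    hne (orderOf_pos _) one_pos]
  · obtain ⟨j, rfl⟩ : ∃ j, k = j + 1 := ⟨k - 1, by omega⟩
    rw [pow_one, pow_one, mul_add, mul_one, coeff_add, coeff_mul_X,
      coeff_one_add_X_pow_pow (orderOf_pos _), coeff_one_add_X_pow_pow (orderOf_pos _)]
    rfl
  · intro y
    by_cases hy : y = Sum.inr c
    · exact Or.inr (hy ▸ hrc)
    · exact Or.inl (hcase y hy)
  · rw [h2, Nat.mul_div_cancel' ((orderOf_dvd_sub_one _).mul_left 2),
      Finset.card_erase_of_mem (Finset.mem_univ _), Finset.card_univ, Fintype.card_sum,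
      card_units_zmod, ZMod.card]
    omega
  · rw [h1]; simp

theorem fixCount_one_add (n : ℕ) {k : ℕ} (hk : 1 ≤ k) :
    fixCount n 1 k + fixCount n 1 (k - 1) = (n + 1).choose k := by
  obtain ⟨j, rfl⟩ : ∃ j, k = j + 1 := ⟨k - 1, by omega⟩
  simp [fixCount, Nat.choose_succ_succ', add_comm]

/-- Each linear part `a ≠ 1` contributes `p * F a`. Extending this to `a = 1` produces the totient
sums, and the remaining terms correct for the identity and the `p - 1` translations. -/
theorem sum_numFixed_aff {k : ℕ} (hk : 1 ≤ k) :
    ((∑ g : Aff p, numFixed ((ZMod p)ˣ ⊕ ZMod p) g k : ℕ) : ℚ) =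
      (p - 1) * ((p - 1).choose k + (if p ≤ k then (p - 1).choose (k - p) else 0 : ℕ)) -
      (p - 1) * (2 * p - 1).choose k +
      p * (totientSum p (2 * (p - 1)) k + totientSum p (2 * (p - 1)) (k - 1)) := by
  have hp1 := hp.out.one_le
  let F : (ZMod p)ˣ → ℕ := fun a =>
    fixCount (2 * (p - 1)) (orderOf a) k + fixCount (2 * (p - 1)) (orderOf a) (k - 1)
  have hF : ((∑ a, F a : ℕ) : ℚ) =
      totientSum p (2 * (p - 1)) k + totientSum p (2 * (p - 1)) (k - 1) := by
    rw [Finset.sum_add_distrib, Nat.cast_add, sum_fixCount, sum_fixCount]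
  have hF1 : F 1 = (2 * p - 1).choose k := by
    simp only [F, orderOf_one, fixCount_one_add _ hk]
    congr 1; omega
  have hrow : ∀ a : (ZMod p)ˣ, a ≠ 1 →
      ∑ b : ZMod p, numFixed ((ZMod p)ˣ ⊕ ZMod p) (⟨a, b⟩ : Aff p) k = p * F a := fun a ha => by
    rw [Finset.sum_congr rfl (g := fun _ => F a)
      (fun b _ => numFixed_aff_of_lin_ne_one (g := ⟨a, b⟩) ha hk)]
    simp
  have hrow1 : ∑ b : ZMod p, numFixed ((ZMod p)ˣ ⊕ ZMod p) (⟨1, b⟩ : Aff p) k =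
      (2 * p - 1).choose k +
        (p - 1) * ((p - 1).choose k + if p ≤ k then (p - 1).choose (k - p) else 0) := by
    rw [← Finset.add_sum_erase _ _ (Finset.mem_univ 0),
      Finset.sum_congr rfl (fun b hb => numFixed_aff_of_lin_eq_one (g := ⟨1, b⟩) rfl
        (Finset.ne_of_mem_erase hb) k), Finset.sum_const,
      Finset.card_erase_of_mem (Finset.mem_univ _), Finset.card_univ, ZMod.card, smul_eq_mul]
    exact congrArg (· + _) (numFixed_aff_one k)
  have hsum : ∑ g : Aff p, numFixed ((ZMod p)ˣ ⊕ ZMod p) g k =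
      (2 * p - 1).choose k +
        (p - 1) * ((p - 1).choose k + (if p ≤ k then (p - 1).choose (k - p) else 0)) +
      p * ∑ a ∈ Finset.univ.erase 1, F a := by
    rw [← Aff.equivProd.symm.sum_comp, Fintype.sum_prod_type,
      ← Finset.add_sum_erase _ _ (Finset.mem_univ 1), Finset.mul_sum]
    exact congrArg₂ (· + ·) hrow1
      (Finset.sum_congr rfl fun a ha => hrow a (Finset.ne_of_mem_erase ha))
  have hE : ∑ a, F a = (2 * p - 1).choose k + ∑ a ∈ Finset.univ.erase 1, F a := by
    rw [← hF1, Finset.add_sum_erase _ _ (Finset.mem_univ 1)]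
  rw [hsum, ← hF, hE]
  push_cast [Nat.cast_sub hp1]
  ring

theorem card_aff : Fintype.card (Aff p) = (p - 1) * p := by
  rw [Fintype.card_congr Aff.equivProd, Fintype.card_prod, card_units_zmod, ZMod.card]

theorem numOrbits_aff_of_subsingleton {k : ℕ} (hk : k = 0 ∨ k = 2 * p - 1) :
    numOrbits (Aff p) ((ZMod p)ˣ ⊕ ZMod p) k = 1 := by
  have hp1 := hp.out.one_le
  have hcard : Nat.card (Set.powersetCard ((ZMod p)ˣ ⊕ ZMod p) k) = 1 := by
    rw [Set.powersetCard.card, Nat.card_eq_fintype_card, Fintype.card_sum, card_units_zmod,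
      ZMod.card]
    rcases hk with rfl | rfl
    · simp
    · rw [show p - 1 + p = 2 * p - 1 by omega]; simp
  obtain ⟨_, ⟨x⟩⟩ := Nat.card_eq_one_iff_unique.mp hcard
  exact Nat.card_eq_one_iff_unique.mpr ⟨inferInstance, ⟨Quotient.mk _ x⟩⟩

theorem numOrbits_aff {k : ℕ} (hk : k ≤ 2 * p - 1) :
    (numOrbits (Aff p) ((ZMod p)ˣ ⊕ ZMod p) k : ℚ) = M p k := by
  by_cases h : k = 0 ∨ k = 2 * p - 1
  · rw [numOrbits_aff_of_subsingleton h, M, if_pos h, Nat.cast_one]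
  have hp1 : (1 : ℚ) < p := by exact_mod_cast hp.out.one_lt
  have hp0 : (p : ℚ) ≠ 0 := by positivity
  have hp2 : (p : ℚ) - 1 ≠ 0 := sub_ne_zero.mpr hp1.ne'
  have hs := sum_numFixed_aff (p := p) (k := k) (by omega)
  rw [sum_numFixed, card_aff] at hs
  push_cast [Nat.cast_sub hp.out.one_le] at hs
  have hN : ∀ x y : ℚ, x * ((p - 1) * p) = y → x = y / ((p - 1) * p) := fun x y h => by
    rw [← h, mul_div_cancel_right₀ _ (mul_ne_zero hp2 hp0)]
  rw [hN _ _ hs, M, if_neg h, M1]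
  have hp3 := hp.out.one_le
  by_cases h1 : p ≤ k
  · rw [if_pos h1, if_neg (by omega), Nat.choose_eq_zero_of_lt (n := p - 1) (k := k) (by omega)]
    push_cast
    field_simp
    ring
  · rw [if_neg h1, if_pos (by omega)]
    field_simp
    ring

/-- There are only `p - 1` units; this makes the subtracted term vanish for `p ≤ k`. -/
theorem Mc_eq_zero {k : ℕ} (hk : p ≤ k) : Mc p k = 0 := by
  have hp1 := hp.out.one_le
  have hempty : IsEmpty (Set.powersetCard (ZMod p)ˣ k) := by
    rw [← Fintype.card_eq_zero_iff, ← Nat.card_eq_fintype_card, Set.powersetCard.card,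
      Nat.card_eq_fintype_card, card_units_zmod, Nat.choose_eq_zero_of_lt (by omega)]
  have : IsEmpty (MulAction.orbitRel.Quotient (ZMod p)ˣ (Set.powersetCard (ZMod p)ˣ k)) :=
    ⟨fun q => q.inductionOn' fun x => hempty.elim x⟩
  rw [← numOrbits_units, numOrbits, Nat.card_of_isEmpty, Nat.cast_zero]

end Count

/-! ### Isomorphism classes as orbits -/

section Classes

theorem numUpToIso_add_not {V : Type*} [Finite V] (P Q : Digraph V → Prop)
    (hQ : ∀ Γ Δ : Digraph V, Nonempty (Γ.Adj ≃r Δ.Adj) → Q Γ → Q Δ) :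
    numUpToIso (fun Γ => P Γ ∧ Q Γ) + numUpToIso (fun Γ => P Γ ∧ ¬ Q Γ) = numUpToIso P := by
  have : Finite (Digraph V) := Finite.of_injective _ Digraph.adj_injective
  have : Finite (Quotient (isoSetoid V)) := Quotient.finite _
  rw [numUpToIso, numUpToIso, numUpToIso, ← Set.ncard_union_eq _ (Set.toFinite _) (Set.toFinite _),
    ← Set.image_union]
  · congr 2
    ext Γ
    simp only [Set.mem_union, Set.mem_ofPred_eq]
    tauto
  · rw [Set.disjoint_left]
    rintro _ ⟨Γ, ⟨_, hΓ⟩, rfl⟩ ⟨Δ, ⟨_, hΔ⟩, h⟩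
    exact hΔ (hQ Γ Δ (Quotient.exact h.symm) hΓ)

theorem numUpToIso_eq_zero {V : Type*} {P : Digraph V → Prop} (h : ∀ Γ, ¬ P Γ) :
    numUpToIso P = 0 := by
  simp [numUpToIso, h]

theorem numUpToIso_range_eq_numOrbits {V G Y : Type*} [Group G] [MulAction G Y] [DecidableEq Y]
    {k : ℕ} (D : Set.powersetCard Y k → Digraph V)
    (hD : ∀ S T, Nonempty ((D S).Adj ≃r (D T).Adj) ↔ ∃ g : G, g • S = T) :
    numUpToIso (fun Γ => ∃ S, Γ = D S) = numOrbits G Y k := by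
  let f : MulAction.orbitRel.Quotient G (Set.powersetCard Y k) → Quotient (isoSetoid V) :=
    Quotient.map' D fun S T h => by
      obtain ⟨g, hg⟩ := h
      exact (isoSetoid V).symm ((hD T S).mpr ⟨g, hg⟩)
  have hf : f.Injective := by
    rintro ⟨S⟩ ⟨T⟩ h
    obtain ⟨g, hg⟩ := (hD T S).mp (Quotient.exact h.symm)
    exact Quotient.sound ⟨g, hg⟩
  have hrange : Quotient.mk (isoSetoid V) '' {Γ | ∃ S, Γ = D S} = Set.range f := by
    ext q
    constructor
    · rintro ⟨_, ⟨S, rfl⟩, rfl⟩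
      exact ⟨Quotient.mk _ S, rfl⟩
    · rintro ⟨⟨S⟩, rfl⟩
      exact ⟨_, ⟨S, rfl⟩, rfl⟩
  rw [numUpToIso, hrange, ← Set.image_univ, Set.ncard_image_of_injective _ hf, Set.ncard_univ]
  rfl

/-- A group automorphism induces an isomorphism of Cayley digraphs. -/
def cayleyIso {V : Type*} [Group V] (φ : V ≃* V) (S : Set V) :
    (cayleyDigraph S).Adj ≃r (cayleyDigraph (φ '' S)).Adj where
  toEquiv := φ.toEquiv
  map_rel_iff' {x y} := by
    change φ y * (φ x)⁻¹ ∈ φ '' S ↔ y * x⁻¹ ∈ S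
    rw [← map_inv, ← map_mul, φ.injective.mem_set_image]

/-- The map `j` parametrizes the allowed connection elements: `haut` turns equal orbits into
isomorphisms, and `hiso` is the converse. -/
theorem numUpToIso_cayley_eq_numOrbits {V G Y : Type*} [Group V] [Group G] [MulAction G Y]
    [DecidableEq Y] {k : ℕ} {j : Y → V} (hj : j.Injective)
    (haut : ∀ g : G, ∃ φ : V ≃* V, ∀ y, φ (j y) = j (g • y))
    (hiso : ∀ S T : Finset Y,
      (cayleyDigraph (j '' S)).Adj ≃r (cayleyDigraph (j '' T)).Adj →
      ∃ g : G, ∀ y, j y ∈ j '' (S : Set Y) ↔ j (g • y) ∈ j '' (T : Set Y)) :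
    numUpToIso (fun Γ => ∃ S : Set.powersetCard Y k, Γ = cayleyDigraph (j '' S.1)) =
      numOrbits G Y k := by
  refine numUpToIso_range_eq_numOrbits (G := G)
    (fun S : Set.powersetCard Y k => cayleyDigraph (j '' (S.1 : Set Y))) fun S T => ⟨?_, ?_⟩
  · rintro ⟨f⟩
    obtain ⟨g, hg⟩ := hiso _ _ f
    simp only [hj.mem_set_image, Finset.mem_coe] at hg
    refine ⟨g, Subtype.ext (Finset.ext fun y => ?_)⟩
    rw [Set.powersetCard.coe_smul, Finset.mem_smul_finset]
    constructor
    · rintro ⟨x, hx, rfl⟩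
      exact (hg x).mp hx
    · intro hy
      exact ⟨g⁻¹ • y, (hg _).mpr (by rwa [smul_inv_smul]), smul_inv_smul g y⟩
  · rintro ⟨g, rfl⟩
    obtain ⟨φ, hφ⟩ := haut g
    have : j '' ((g • S : Set.powersetCard Y k) : Finset Y) = φ '' (j '' (S : Finset Y)) := by
      rw [Set.powersetCard.coe_smul, Finset.coe_smul_finset, ← Set.image_smul, Set.image_image,
        Set.image_image]
      simp only [hφ]
    change Nonempty ((cayleyDigraph (j '' (S : Finset Y))).Adj ≃r
      (cayleyDigraph (j '' ((g • S : Set.powersetCard Y k) : Finset Y))).Adj)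
    rw [this]
    exact ⟨cayleyIso φ _⟩

theorem hasOutDegree_cayleyDigraph {V : Type*} [Group V] {S : Set V} {k : ℕ} :
    HasOutDegree (cayleyDigraph S) k ↔ S.ncard = k := by
  have h : ∀ v : V, {w | (cayleyDigraph S).Adj v w}.ncard = S.ncard := fun v => by
    rw [← Set.ncard_image_of_injective S (mul_left_injective v)]
    congr 1
    ext w
    simp only [cayleyDigraph, Set.mem_ofPred_eq, Set.mem_image]
    exact ⟨fun h => ⟨_, h, by simp⟩, by rintro ⟨s, hs, rfl⟩; simpa using hs⟩
  exact ⟨fun hk => (h 1).symm.trans (hk 1), fun hk v => (h v).trans hk⟩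

theorem exists_powersetCard_iff {V Y : Type*} [Finite Y] [Group V] {j : Y → V}
    (hj : j.Injective) {k : ℕ} {Γ : Digraph V} :
    (∃ S : Set.powersetCard Y k, Γ = cayleyDigraph (j '' S.1)) ↔
      ∃ S : Set V, S ⊆ Set.range j ∧ S.ncard = k ∧ Γ = cayleyDigraph S := by
  constructor
  · rintro ⟨S, rfl⟩
    refine ⟨_, Set.image_subset_range _ _, ?_, rfl⟩
    rw [Set.ncard_image_of_injective _ hj, Set.ncard_coe_finset]
    exact S.2
  · rintro ⟨S, hS, hk, rfl⟩
    obtain ⟨S, rfl⟩ := Set.subset_range_iff_exists_image_eq.mp hS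
    rw [Set.ncard_image_of_injective _ hj] at hk
    refine ⟨⟨(Set.toFinite S).toFinset, ?_⟩, by simp⟩
    rw [Set.powersetCard.mem_iff, ← Set.ncard_eq_toFinset_card]
    exact hk

theorem isCayleyDigraph_and_hasOutDegree_iff {V : Type*} [Group V] {k : ℕ} {Γ : Digraph V} :
    IsCayleyDigraph Γ ∧ HasOutDegree Γ k ↔
      ∃ S : Set V, 1 ∉ S ∧ S.ncard = k ∧ Γ = cayleyDigraph S := by
  constructor
  · rintro ⟨⟨S, h1, rfl⟩, hk⟩
    exact ⟨S, h1, hasOutDegree_cayleyDigraph.mp hk, rfl⟩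
  · rintro ⟨S, h1, hk, rfl⟩
    exact ⟨⟨S, h1, rfl⟩, hasOutDegree_cayleyDigraph.mpr hk⟩

end Classes

/-! ### Connectedness and generation -/

section Connected

theorem IsConnectedDigraph.of_iso {V : Type*} {Γ Δ : Digraph V} (f : Nonempty (Γ.Adj ≃r Δ.Adj))
    (h : IsConnectedDigraph Γ) : IsConnectedDigraph Δ := by
  obtain ⟨f⟩ := f
  have e : Γ.toSimpleGraphInclusive ≃g Δ.toSimpleGraphInclusive :=
    { toEquiv := f.toEquiv
      map_rel_iff' := by
        intro x y
        simp [Digraph.toSimpleGraphInclusive, f.map_rel_iff] }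
  exact e.connected_iff.mp h

/-- Neighbours differ by left multiplication by an element of `S` or its inverse, so a walk starting
in `H` never leaves it. -/
theorem eq_top_of_isConnectedDigraph {V : Type*} [Group V] {S : Set V} {H : Subgroup V}
    (hS : S ⊆ H) (h : IsConnectedDigraph (cayleyDigraph S)) : H = ⊤ := by
  rw [Subgroup.eq_top_iff']
  intro x
  have key : ∀ u v, (cayleyDigraph S).toSimpleGraphInclusive.Walk u v → u ∈ H → v ∈ H := by
    intro u v w
    induction w with
    | nil => exact id
    | @cons u v _ huv _ ih =>
      intro hu
      refine ih ?_
      simp only [Digraph.toSimpleGraphInclusive, SimpleGraph.fromRel_adj, cayleyDigraph] at huv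
      rcases huv.2 with h | h
      · exact (Subgroup.mul_mem_cancel_right H (H.inv_mem hu)).mp (hS h)
      · exact H.inv_mem_iff.mp ((Subgroup.mul_mem_cancel_left H hu).mp (hS h))
  obtain ⟨w⟩ := h.preconnected 1 x
  exact key 1 x w H.one_mem

theorem isConnectedDigraph_of_closure_eq_top {V : Type*} [Group V] {S : Set V}
    (h : Subgroup.closure S = ⊤) : IsConnectedDigraph (cayleyDigraph S) := by
  have hreach : ∀ g ∈ Subgroup.closure S,
      ∀ x, (cayleyDigraph S).toSimpleGraphInclusive.Reachable x (g * x) := by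
    intro g hg
    induction hg using Subgroup.closure_induction with
    | mem g hg =>
      intro x
      by_cases hx : x = g * x
      · rw [← hx]
      · refine SimpleGraph.Adj.reachable ?_
        simp only [Digraph.toSimpleGraphInclusive, SimpleGraph.fromRel_adj, cayleyDigraph]
        exact ⟨hx, Or.inl (by simpa using hg)⟩
    | one => intro x; rw [one_mul]
    | mul a b _ _ ha hb => intro x; rw [mul_assoc]; exact (hb x).trans (ha _)
    | inv a _ ha => intro x; simpa using (ha (a⁻¹ * x)).symm
  refine ⟨fun x y => ?_⟩
  simpa using hreach (y * x⁻¹) (h ▸ Subgroup.mem_top _) x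

open DihedralGroup

variable {p : ℕ}

theorem not_isConnectedDigraph_of_subset_zpowers (hp : p.Prime) {S : Set (DihedralGroup p)}
    {g : DihedralGroup p} (hS : S ⊆ Subgroup.zpowers g) :
    ¬ IsConnectedDigraph (cayleyDigraph S) := fun h =>
  DihedralGroup.not_isCyclic hp.ne_one
    ⟨g, fun x => show x ∈ Subgroup.zpowers g from
      (eq_top_of_isConnectedDigraph hS h).symm ▸ Subgroup.mem_top x⟩

theorem r_mem_zpowers (x : ZMod p) : r x ∈ Subgroup.zpowers (r 1 : DihedralGroup p) := by
  obtain ⟨n, rfl⟩ := ZMod.intCast_surjective x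
  exact ⟨n, by simp⟩

/-- A reflection and a second nonidentity element yield a nontrivial rotation, which generates all
rotations because `p` is prime. -/
theorem closure_eq_top_of_sr_mem (hp : p.Prime) {S : Set (DihedralGroup p)} (h1 : 1 ∉ S)
    (hk : 2 ≤ S.ncard) {b : ZMod p} (hb : sr b ∈ S) : Subgroup.closure S = ⊤ := by
  have : Fact p.Prime := ⟨hp⟩
  obtain ⟨i, hi, hi0⟩ : ∃ i, r i ∈ Subgroup.closure S ∧ i ≠ 0 := by
    obtain ⟨x, hx, hxb⟩ := Set.exists_ne_of_one_lt_ncard hk (sr b)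
    rcases x with i | c
    · exact ⟨i, Subgroup.subset_closure hx, fun h => h1 (by rwa [h] at hx)⟩
    · refine ⟨c - b, ?_, sub_ne_zero.mpr fun h => hxb (h ▸ rfl)⟩
      exact Subgroup.mul_mem _ (Subgroup.subset_closure hb) (Subgroup.subset_closure hx)
  have hr : ∀ x, r x ∈ Subgroup.closure S := fun x => by
    have := Subgroup.pow_mem _ hi (i⁻¹ * x).val
    rwa [r_pow, ZMod.natCast_zmod_val, mul_inv_cancel_left₀ hi0] at this
  rw [Subgroup.eq_top_iff']
  rintro (x | x)
  · exact hr x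
  · simpa using Subgroup.mul_mem _ (Subgroup.subset_closure hb) (hr (x - b))

end Connected

/-! ### Application to dihedral and cyclic groups -/

section Dihedral

open DihedralGroup

variable {p : ℕ}

/-- The nontrivial elements of the dihedral group. -/
def dihedralElt : (ZMod p)ˣ ⊕ ZMod p → DihedralGroup p
  | Sum.inl u => r u
  | Sum.inr x => sr x

/-- The automorphism of the dihedral group given by an affine map. -/
def affAut (g : Aff p) : DihedralGroup p ≃* DihedralGroup p where
  toFun
    | r x => r (g.lin * x)
    | sr x => sr (g.lin * x + g.trans)
  invFun
    | r x => r (↑g.lin⁻¹ * x)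
    | sr x => sr (↑g.lin⁻¹ * (x - g.trans))
  left_inv := by rintro (x | x) <;> simp
  right_inv := by rintro (x | x) <;> simp
  map_mul' := by rintro (x | x) (y | y) <;> simp <;> ring

theorem dihedralElt_injective : (dihedralElt : (ZMod p)ˣ ⊕ ZMod p → _).Injective := by
  rintro (u | x) (v | y) h <;> simp [dihedralElt, Units.ext_iff] at h ⊢ <;> exact h

theorem subset_range_units_iff (hp : p.Prime) {S : Set (DihedralGroup p)} :
    S ⊆ Set.range (fun u : (ZMod p)ˣ => r (u : ZMod p)) ↔ 1 ∉ S ∧ ∀ b, sr b ∉ S := by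
  have : Fact p.Prime := ⟨hp⟩
  constructor
  · refine fun h => ⟨fun h1 => ?_, fun b hb => ?_⟩
    · obtain ⟨u, hu⟩ := h h1
      rw [DihedralGroup.one_def, r.injEq] at hu
      exact u.ne_zero hu
    · obtain ⟨u, hu⟩ := h hb
      cases hu
  · rintro ⟨h1, hb⟩ (x | x) hx
    · exact ⟨Units.mk0 x fun h => h1 (by rwa [h] at hx), rfl⟩
    · exact absurd hx (hb x)

theorem subset_range_dihedralElt_iff (hp : p.Prime) {S : Set (DihedralGroup p)} :
    S ⊆ Set.range dihedralElt ↔ 1 ∉ S := by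
  have : Fact p.Prime := ⟨hp⟩
  constructor
  · rintro h h1
    obtain ⟨u | x, hu⟩ := h h1
    · rw [dihedralElt, DihedralGroup.one_def, r.injEq] at hu
      exact u.ne_zero hu
    · cases hu
  · rintro h1 (x | x) hx
    · exact ⟨Sum.inl (Units.mk0 x fun h => h1 (by rwa [h] at hx)), rfl⟩
    · exact ⟨Sum.inr x, rfl⟩

theorem numDihedral_eq_numOrbits (hp : p.Prime) (hodd : Odd p) (k : ℕ) :
    numDihedral p k = numOrbits (Aff p) ((ZMod p)ˣ ⊕ ZMod p) k := by
  have : Fact p.Prime := ⟨hp⟩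
  rw [← numUpToIso_cayley_eq_numOrbits dihedralElt_injective (fun g => ⟨affAut g, ?_⟩) ?_,
    numDihedral]
  · congr 1
    ext Γ
    rw [isCayleyDigraph_and_hasOutDegree_iff, exists_powersetCard_iff dihedralElt_injective]
    simp only [subset_range_dihedralElt_iff hp]
  · intro S T f
    obtain ⟨a, b, hr, hsr⟩ := exists_affine_of_iso_dihedral hp hodd f
    refine ⟨⟨a, b⟩, ?_⟩
    rintro (u | x)
    · simpa [dihedralElt] using hr u
    · exact hsr x
  · rintro (u | x)
    · exact congrArg r (Units.val_mul g.lin u).symm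
    · rfl

theorem r_units_injective : (fun u : (ZMod p)ˣ => r (u : ZMod p)).Injective := fun u v h => by
  simpa [Units.ext_iff] using h

/-- Disconnected connection sets consist of nontrivial rotations, on which an affine automorphism
acts only through its linear part. -/
theorem numUpToIso_not_connected (hp : p.Prime) (hodd : Odd p) {k : ℕ} (hk : 2 ≤ k) :
    numUpToIso (fun Γ : Digraph (DihedralGroup p) =>
      (IsCayleyDigraph Γ ∧ HasOutDegree Γ k) ∧ ¬ IsConnectedDigraph Γ) =
      numOrbits (ZMod p)ˣ (ZMod p)ˣ k := by
  have : Fact p.Prime := ⟨hp⟩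
  rw [← numUpToIso_cayley_eq_numOrbits r_units_injective (fun a => ⟨affAut ⟨a, 0⟩, ?_⟩) ?_]
  · congr 1
    ext Γ
    rw [isCayleyDigraph_and_hasOutDegree_iff, exists_powersetCard_iff r_units_injective]
    simp only [subset_range_units_iff hp]
    constructor
    · rintro ⟨⟨S, h1, hS, rfl⟩, hc⟩
      exact ⟨S, ⟨h1, fun b hb => hc (isConnectedDigraph_of_closure_eq_top
        (closure_eq_top_of_sr_mem hp h1 (hS ▸ hk) hb))⟩, hS, rfl⟩
    · rintro ⟨S, ⟨h1, hb⟩, hS, rfl⟩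
      refine ⟨⟨S, h1, hS, rfl⟩, not_isConnectedDigraph_of_subset_zpowers hp (g := r 1) ?_⟩
      rintro (x | x) hx
      · exact r_mem_zpowers x
      · exact absurd hx (hb x)
  · intro S T f
    obtain ⟨a, b, hr, -⟩ := exists_affine_of_iso_dihedral hp hodd f
    exact ⟨a, fun u => by simpa using hr u⟩
  · intro u
    exact congrArg r (Units.val_mul a u).symm

theorem numConnectedDihedral_add (k : ℕ) [NeZero p] :
    numConnectedDihedral p k + numUpToIso (fun Γ : Digraph (DihedralGroup p) =>
      (IsCayleyDigraph Γ ∧ HasOutDegree Γ k) ∧ ¬ IsConnectedDigraph Γ) = numDihedral p k := by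
  rw [numDihedral, numConnectedDihedral]
  simp only [← and_assoc]
  exact numUpToIso_add_not _ IsConnectedDigraph fun _ _ => IsConnectedDigraph.of_iso

theorem numConnectedDihedral_eq_zero (hp : p.Prime) {k : ℕ} (hk : k = 0 ∨ k = 1) :
    numConnectedDihedral p k = 0 := by
  have : NeZero p := ⟨hp.ne_zero⟩
  refine numUpToIso_eq_zero fun Γ ⟨hC, hO, hconn⟩ => ?_
  obtain ⟨S, -, hS, rfl⟩ := isCayleyDigraph_and_hasOutDegree_iff.mp ⟨hC, hO⟩
  obtain ⟨g, hg⟩ : ∃ g, S ⊆ {g} := by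
    rcases hk with rfl | rfl
    · exact ⟨1, by simp [(Set.ncard_eq_zero (Set.toFinite S)).mp hS]⟩
    · obtain ⟨g, rfl⟩ := Set.ncard_eq_one.mp hS
      exact ⟨g, subset_rfl⟩
  refine not_isConnectedDigraph_of_subset_zpowers hp (g := g) (fun x hx => ?_) hconn
  rw [Set.mem_singleton_iff.mp (hg hx)]
  exact Subgroup.mem_zpowers g

theorem numCirculant_eq_numOrbits (hp : p.Prime) (hodd : Odd p) (k : ℕ) :
    numCirculant p k = numOrbits (ZMod p)ˣ (ZMod p)ˣ k := by
  have : Fact p.Prime := ⟨hp⟩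
  have hinj : (fun u : (ZMod p)ˣ => Multiplicative.ofAdd (u : ZMod p)).Injective := fun u v h =>
    Units.ext (Multiplicative.ofAdd.injective h)
  rw [← numUpToIso_cayley_eq_numOrbits hinj
    (fun a => ⟨AddEquiv.toMultiplicative (AddAut.mulLeft a), ?_⟩) ?_, numCirculant]
  · congr 1
    ext Γ
    rw [isCayleyDigraph_and_hasOutDegree_iff, exists_powersetCard_iff hinj]
    refine exists_congr fun S => and_congr_left fun _ => ⟨fun h1 x hx => ?_, fun h h1 => ?_⟩
    · exact ⟨Units.mk0 x.toAdd fun h => h1 (by rwa [toAdd_eq_zero.mp h] at hx), rfl⟩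
    · obtain ⟨u, hu⟩ := h h1
      exact u.ne_zero (ofAdd_eq_one.mp hu)
  · intro S T f
    obtain ⟨a, ha⟩ := exists_unit_of_iso_circulant hp hodd f
    exact ⟨a, fun u => by simpa using ha u⟩
  · intro u
    rfl

end Dihedral

end CayleyEnum

theorem mainTheorem6 (p : ℕ) (hp : p.Prime) (hodd : Odd p) :
    (∀ k : ℕ, k = 0 ∨ k = 1 → CayleyEnum.numConnectedDihedral p k = 0) ∧
    (∀ k : ℕ, 2 ≤ k → k ≤ p - 1 →
      (CayleyEnum.numConnectedDihedral p k : ℚ) = CayleyEnum.M p k - CayleyEnum.Mc p k) ∧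
    (∀ k : ℕ, p ≤ k → k ≤ 2 * p - 1 →
      (CayleyEnum.numConnectedDihedral p k : ℚ) = CayleyEnum.M p k) ∧
    (∀ k : ℕ, k ≤ 2 * p - 1 → (CayleyEnum.numDihedral p k : ℚ) = CayleyEnum.M p k) ∧
    (∀ k : ℕ, (CayleyEnum.numCirculant p k : ℚ) = CayleyEnum.Mc p k) := by
  have : Fact p.Prime := ⟨hp⟩
  have h2 := hp.two_le
  have hall : ∀ k, k ≤ 2 * p - 1 → (CayleyEnum.numDihedral p k : ℚ) = CayleyEnum.M p k :=
    fun k hk => by rw [CayleyEnum.numDihedral_eq_numOrbits hp hodd, CayleyEnum.numOrbits_aff hk]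
  have hconn : ∀ k, 2 ≤ k → k ≤ 2 * p - 1 →
      (CayleyEnum.numConnectedDihedral p k : ℚ) = CayleyEnum.M p k - CayleyEnum.Mc p k :=
    fun k hk hk' => by
      rw [← hall k hk', ← CayleyEnum.numConnectedDihedral_add k,
        CayleyEnum.numUpToIso_not_connected hp hodd hk, Nat.cast_add, CayleyEnum.numOrbits_units]
      ring
  refine ⟨fun k => CayleyEnum.numConnectedDihedral_eq_zero hp,
    fun k hk hk' => hconn k hk (by omega), fun k hk hk' => ?_, hall, fun k => by
      rw [CayleyEnum.numCirculant_eq_numOrbits hp hodd, CayleyEnum.numOrbits_units]⟩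
  rw [hconn k (by omega) hk', CayleyEnum.Mc_eq_zero hk, sub_zero]
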